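/- Let $(M,g)$ be a smooth Riemannian manifold and let $\mathcal{E}\subset TM$ be a $k$-foliation, i.e. a smooth integrable (involutive) distribution of rank $k$. Let $\pi^{\perp}$ be the $g$-orthogonal projection of $TM$ onto $\mathcal{E}^{\perp}$, and write $\nabla\phi$ for the $g$-gradient of a smooth function $\phi$. For a metric $g$ on $M$ with Levi-Civita connection $\nabla$ put $h(X,Y)=\pi^{\perp}\nabla_XY$ for local sections $X,Y$ of $\mathcal{E}$, and $H=\sum_{i=1}^k h(\xi_i,\xi_i)$ for any local $g$-orthonormal frame $\xi_1,\dots,\xi_k$ of $\mathcal{E}$ (the mean curvature vector). The foliation is called minimal with respect to $g$ if $H=0$, and totally geodesic with respect to $g$ if $h=0$; it is called conformally minimal if it is minimal with respect to some metric $e^{2\phi}g$, $\phi\in C^\infty(M)$. Then: (a) For every $\phi\in C^\infty(M)$, the mean curvature vector $\bar H$ of $\mathcal{E}$ with respect to $\bar g=e^{2\phi}g$ is $$\bar H=e^{-2\phi}\bigl(H-k\,\pi^{\perp}\nabla\phi\bigr).$$ (b) If $k\ge 1$, then $(M,\mathcal{E},g)$ is conformally minimal if and only if there is $\phi\in C^\infty(M)$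 with $\pi^{\perp}\nabla\phi=\frac1k H$; and for every such $\phi$ the foliation is minimal with respect to $\bar g=e^{2\phi}g$. (c) If $k\ge 1$ and $\mathcal{E}$ is totally geodesic with respect to $g$, then for every $\phi\in C^\infty(M)$, $\mathcal{E}$ is totally geodesic with respect to $\bar g=e^{2\phi}g$ if and only if $\nabla\phi\in\mathcal{E}$ at every point of $M$. -/

import Mathlib

open scoped Manifold ContDiff

noncomputable section

namespace ConfFol

open scoped Pointwise Topology
open Bundle FiberBundle Manifold VectorField

variable {E : Type*} [NormedAddCommGroup E] [NormedSpace ℝ E]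
  {H : Type*} [TopologicalSpace H] {I : ModelWithCorners ℝ E H}
  {M : Type*} [TopologicalSpace M] [ChartedSpace H M] [IsManifold I ∞ M] {k : ℕ}

/-- Smooth Riemannian metrics on `M`. -/
abbrev RMetric (I : ModelWithCorners ℝ E H) (M : Type*) [TopologicalSpace M] [ChartedSpace H M]
    [IsManifold I ∞ M] :=
  ContMDiffRiemannianMetric I ∞ E (fun x : M ↦ TangentSpace I x)

/-- Vector fields on `M`, with no regularity required. -/
abbrev VField (I : ModelWithCorners ℝ E H) (M : Type*) [TopologicalSpace M] [ChartedSpace H M] :=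
  (x : M) → TangentSpace I x

/-- The pairing of two vector fields differentiable at `x` is differentiable at `x`. -/
theorem RMetric.mdifferentiableAt (g : RMetric I M) {Y Z : VField I M} {x : M}
    (hY : MDiffAt (T% Y) x) (hZ : MDiffAt (T% Z) x) :
    MDiffAt (fun y ↦ g.inner y (Y y) (Z y)) x := by
  have : MDifferentiableWithinAt I (I.prod 𝓘(ℝ))
      (fun m ↦ TotalSpace.mk' ℝ (E := Bundle.Trivial M ℝ) m (g.inner m (Y m) (Z m))) Set.univ x := by
    apply MDifferentiableWithinAt.clm_bundle_apply₂ (F₁ := E) (F₂ := E)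
    · exact (g.contMDiff.mdifferentiableAt (by simp)).mdifferentiableWithinAt
    · exact hY.mdifferentiableWithinAt
    · exact hZ.mdifferentiableWithinAt
  simp only [mdifferentiableWithinAt_totalSpace] at this
  exact mdifferentiableWithinAt_univ.1 this.2

/-- The conformally changed metric `e^{2φ} g`. -/
def conformalChange (g : RMetric I M) (φ : C^∞⟮I, M; ℝ⟯) : RMetric I M where
  inner x := Real.exp (2 * φ x) • g.inner x
  symm x v w := by simp [g.symm x v w]
  pos x v hv := by simpa using mul_pos (Real.exp_pos _) (g.pos x v hv)
  isVonNBounded x := by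
    have hc : 0 < Real.exp (φ x) := Real.exp_pos _
    have h : {v : TangentSpace I x | (Real.exp (2 * φ x) • g.inner x) v v < 1} =
        (Real.exp (φ x))⁻¹ • {v : TangentSpace I x | g.inner x v v < 1} := by
      ext v
      rw [Set.mem_inv_smul_set_iff₀ hc.ne']
      simp only [Set.mem_ofPred_eq, smul_apply, map_smul, smul_eq_mul,
        two_mul, Real.exp_add, mul_assoc]
    rw [h]
    exact (g.isVonNBounded x).image ((Real.exp (φ x))⁻¹ • ContinuousLinearMap.id ℝ _)
  contMDiff := by
    have := g.contMDiff
    have h2 : ContMDiff I 𝓘(ℝ) ∞ (fun x ↦ Real.exp (2 * φ x)) :=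
      Real.contDiff_exp.comp_contMDiff (contMDiff_const.mul φ.contMDiff)
    exact ContMDiff.smul_section h2 this

/-- The right-hand side of the Koszul formula for `2 g(∇_X Y, Z)` at the point `x`. -/
def koszul (g : RMetric I M) (X Y Z : VField I M) (x : M) : ℝ :=
  d% (fun y ↦ g.inner y (Y y) (Z y)) x (X x) + d% (fun y ↦ g.inner y (X y) (Z y)) x (Y x)
    - d% (fun y ↦ g.inner y (X y) (Y y)) x (Z x)
    + g.inner x (mlieBracket I X Y x) (Z x) - g.inner x (mlieBracket I X Z x) (Y x)
    - g.inner x (mlieBracket I Y Z x) (X x)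

theorem flat_injective (g : RMetric I M) (x : M) :
    Function.Injective (g.inner x) := by
  rw [injective_iff_map_eq_zero]
  intro v hv
  by_contra h
  have := g.pos x v h
  simp [hv] at this

/-- A `k`-foliation: a smooth rank `k` distribution `x ↦ plane x` that is integrable, i.e. closed
under the Lie bracket of local sections (Frobenius). -/
structure Foliation (I : ModelWithCorners ℝ E H) (M : Type*) [TopologicalSpace M]
    [ChartedSpace H M] [IsManifold I ∞ M] (k : ℕ) where
  /-- The fibre of the distribution at `x`. -/
  plane (x : M) : Submodule ℝ (TangentSpace I x)
  exists_frame (x : M) : ∃ U : Set M, IsOpen U ∧ x ∈ U ∧ ∃ s : Fin k → VField I M,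
    (∀ i, CMDiff[U] ∞ (T% (s i))) ∧ ∀ y ∈ U, LinearIndependent ℝ (fun i ↦ s i y) ∧
      Submodule.span ℝ (Set.range fun i ↦ s i y) = plane y
  involutive (U : Set M) (hU : IsOpen U) (X Y : VField I M)
    (hX : CMDiff[U] ∞ (T% X)) (hY : CMDiff[U] ∞ (T% Y))
    (hXp : ∀ y ∈ U, X y ∈ plane y) (hYp : ∀ y ∈ U, Y y ∈ plane y) :
    ∀ y ∈ U, mlieBracket I X Y y ∈ plane y

/-- `ξ` is a smooth `g`-orthonormal frame of the foliation over the set `U`. -/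
structure IsOrthonormalFrame (g : RMetric I M) (F : Foliation I M k) (U : Set M)
    (ξ : Fin k → VField I M) : Prop where
  smooth : ∀ i, CMDiff[U] ∞ (T% (ξ i))
  orthonormal : ∀ y ∈ U, ∀ i j, g.inner y (ξ i y) (ξ j y) = if i = j then 1 else 0
  span_eq : ∀ y ∈ U, Submodule.span ℝ (Set.range fun i ↦ ξ i y) = F.plane y

theorem RMetric.contMDiffOn (g : RMetric I M) {Y Z : VField I M} {U : Set M}
    (hY : CMDiff[U] ∞ (T% Y)) (hZ : CMDiff[U] ∞ (T% Z)) :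
    CMDiff[U] ∞ (fun y ↦ g.inner y (Y y) (Z y)) := by
  have : ContMDiffOn I (I.prod 𝓘(ℝ)) ∞
      (fun m ↦ TotalSpace.mk' ℝ (E := Bundle.Trivial M ℝ) m (g.inner m (Y m) (Z m))) U :=
    ContMDiffOn.clm_bundle_apply₂ (F₁ := E) (F₂ := E) g.contMDiff.contMDiffOn hY hZ
  intro x hx
  exact (contMDiffWithinAt_totalSpace.1 (this x hx)).2

/-- Local orthonormal frames exist, by the Gram-Schmidt process. -/
theorem exists_orthonormalFrame (g : RMetric I M) (F : Foliation I M k) (x : M) :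
    ∃ U : Set M, IsOpen U ∧ x ∈ U ∧ ∃ ξ, IsOrthonormalFrame g F U ξ := by
  obtain ⟨U, hU, hxU, s, hs, hsp⟩ := F.exists_frame x
  refine ⟨U, hU, hxU, ?_⟩
  let : RiemannianBundle (fun x : M ↦ TangentSpace I x) := ⟨g.toRiemannianMetric⟩
  have hin (y : M) (v w : TangentSpace I y) : g.inner y v w = inner ℝ v w := rfl
  have key : ∀ i : Fin k, CMDiff[U] ∞
      (T% (fun y ↦ InnerProductSpace.gramSchmidt ℝ (fun i ↦ s i y) i : VField I M)) := by
    intro i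
    induction i using WellFoundedLT.induction with
    | ind i ih =>
      have heq : (fun y ↦ InnerProductSpace.gramSchmidt ℝ (fun i ↦ s i y) i : VField I M) =
          s i - (fun y ↦ ∑ j ∈ Finset.Iio i,
            (g.inner y (InnerProductSpace.gramSchmidt ℝ (fun i ↦ s i y) j) (s i y) /
              g.inner y (InnerProductSpace.gramSchmidt ℝ (fun i ↦ s i y) j)
                (InnerProductSpace.gramSchmidt ℝ (fun i ↦ s i y) j)) •
              InnerProductSpace.gramSchmidt ℝ (fun i ↦ s i y) j : VField I M) := by
        ext y
        have := InnerProductSpace.gramSchmidt_def'' ℝ (fun i ↦ s i y) i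
        simp only [Pi.sub_apply, hin, real_inner_self_eq_norm_sq]
        exact eq_sub_of_add_eq this.symm
      refine ContMDiffOn.congr ?_ fun y _ ↦ congrArg (TotalSpace.mk' E y) (congrFun heq y)
      refine (hs i).sub_section (ContMDiffOn.sum_section fun j hj ↦ ?_)
      have hj := ih j (Finset.mem_Iio.1 hj)
      refine ContMDiffOn.smul_section (ContMDiffOn.div₀ (g.contMDiffOn hj (hs i))
        (g.contMDiffOn hj hj) fun y hy ↦ ?_) hj
      exact (g.pos _ _ (InnerProductSpace.gramSchmidt_ne_zero j (hsp y hy).1)).ne'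
  refine ⟨fun i y ↦ InnerProductSpace.gramSchmidtNormed ℝ (fun i ↦ s i y) i, ?_, ?_, ?_⟩
  · intro i
    have heq : (fun y ↦ InnerProductSpace.gramSchmidtNormed ℝ (fun i ↦ s i y) i : VField I M) =
        (fun y ↦ (Real.sqrt (g.inner y (InnerProductSpace.gramSchmidt ℝ (fun i ↦ s i y) i)
                (InnerProductSpace.gramSchmidt ℝ (fun i ↦ s i y) i)))⁻¹ •
              InnerProductSpace.gramSchmidt ℝ (fun i ↦ s i y) i : VField I M) := by
      ext y
      simp only [hin, InnerProductSpace.gramSchmidtNormed, norm_eq_sqrt_real_inner]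
      rfl
    refine ContMDiffOn.congr ?_ fun y _ ↦ congrArg (TotalSpace.mk' E y) (congrFun heq y)
    have hpos : ∀ y ∈ U, 0 < g.inner y (InnerProductSpace.gramSchmidt ℝ (fun i ↦ s i y) i)
        (InnerProductSpace.gramSchmidt ℝ (fun i ↦ s i y) i) := fun y hy ↦
      g.pos _ _ (InnerProductSpace.gramSchmidt_ne_zero i (hsp y hy).1)
    refine ContMDiffOn.smul_section (ContMDiffOn.inv₀ ?_ fun y hy ↦ ?_) (key i)
    · intro y hy
      exact ContMDiffAt.comp_contMDiffWithinAt y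
        ((Real.contDiffAt_sqrt (hpos y hy).ne').contMDiffAt) (g.contMDiffOn (key i) (key i) y hy)
    · exact (Real.sqrt_pos.2 (hpos y hy)).ne'
  · intro y hy i j
    exact orthonormal_iff_ite.1 (InnerProductSpace.gramSchmidtNormed_orthonormal (hsp y hy).1) i j
  · intro y hy
    rw [← (hsp y hy).2]
    exact (InnerProductSpace.span_gramSchmidtNormed_range _).trans
      (InnerProductSpace.span_gramSchmidt ℝ _)

theorem eq_of_inner_eq (g : RMetric I M) {x : M} {u w : TangentSpace I x}
    (h : ∀ v, g.inner x u v = g.inner x w v) : u = w :=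
  flat_injective g x (ContinuousLinearMap.ext h)

variable [FiniteDimensional ℝ E]

instance tangentSpace_finiteDimensional (x : M) : FiniteDimensional ℝ (TangentSpace I x) :=
  inferInstanceAs (FiniteDimensional ℝ E)

instance tangentSpace_t2Space (x : M) : T2Space (TangentSpace I x) := inferInstanceAs (T2Space E)

theorem koszul_left (g : RMetric I M) {Y Z : VField I M} {x : M}
    (hY : MDiffAt (T% Y) x) (hZ : MDiffAt (T% Z) x) :
    TensorialAt I E (fun X : VField I M ↦ koszul g X Y Z x) x where
  smul {f X} hf hX := by
    have h1 : (fun y ↦ g.inner y ((f • X) y) (Z y)) = fun y ↦ f y * g.inner y (X y) (Z y) := by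
      ext; simp
    have h2 : (fun y ↦ g.inner y ((f • X) y) (Y y)) = fun y ↦ f y * g.inner y (X y) (Y y) := by
      ext; simp
    simp only [koszul]
    rw [h1, h2, mvfderiv_fun_mul hf (g.mdifferentiableAt hX hZ),
      mvfderiv_fun_mul hf (g.mdifferentiableAt hX hY), mlieBracket_smul_left hf hX,
      mlieBracket_smul_left hf hX]
    simp
    ring
  add {X X'} hX hX' := by
    have h1 : (fun y ↦ g.inner y ((X + X') y) (Z y)) =
        fun y ↦ g.inner y (X y) (Z y) + g.inner y (X' y) (Z y) := by
      ext; simp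
    have h2 : (fun y ↦ g.inner y ((X + X') y) (Y y)) =
        fun y ↦ g.inner y (X y) (Y y) + g.inner y (X' y) (Y y) := by
      ext; simp
    simp only [koszul]
    rw [h1, h2, mvfderiv_fun_add (g.mdifferentiableAt hX hZ) (g.mdifferentiableAt hX' hZ),
      mvfderiv_fun_add (g.mdifferentiableAt hX hY) (g.mdifferentiableAt hX' hY),
      mlieBracket_add_left hX hX', mlieBracket_add_left hX hX']
    simp
    ring

theorem koszul_right (g : RMetric I M) {X Y : VField I M} {x : M}
    (hX : MDiffAt (T% X) x) (hY : MDiffAt (T% Y) x) :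
    TensorialAt I E (fun Z : VField I M ↦ koszul g X Y Z x) x where
  smul {f Z} hf hZ := by
    have h1 : (fun y ↦ g.inner y (X y) ((f • Z) y)) = fun y ↦ f y * g.inner y (X y) (Z y) := by
      ext; simp
    have h2 : (fun y ↦ g.inner y (Y y) ((f • Z) y)) = fun y ↦ f y * g.inner y (Y y) (Z y) := by
      ext; simp
    simp only [koszul]
    rw [h1, h2, mvfderiv_fun_mul hf (g.mdifferentiableAt hX hZ),
      mvfderiv_fun_mul hf (g.mdifferentiableAt hY hZ), mlieBracket_smul_right hf hZ,
      mlieBracket_smul_right hf hZ]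
    simp [g.symm x (Z x)]
    ring
  add {Z Z'} hZ hZ' := by
    have h1 : (fun y ↦ g.inner y (X y) ((Z + Z') y)) =
        fun y ↦ g.inner y (X y) (Z y) + g.inner y (X y) (Z' y) := by
      ext; simp
    have h2 : (fun y ↦ g.inner y (Y y) ((Z + Z') y)) =
        fun y ↦ g.inner y (Y y) (Z y) + g.inner y (Y y) (Z' y) := by
      ext; simp
    simp only [koszul]
    rw [h1, h2, mvfderiv_fun_add (g.mdifferentiableAt hX hZ) (g.mdifferentiableAt hX hZ'),
      mvfderiv_fun_add (g.mdifferentiableAt hY hZ) (g.mdifferentiableAt hY hZ'),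
      mlieBracket_add_right hZ hZ', mlieBracket_add_right hZ hZ']
    simp
    ring

/-- The isomorphism `v ↦ g(v, ·)` from the tangent space to the cotangent space. -/
def flat (g : RMetric I M) (x : M) :
    TangentSpace I x ≃ₗ[ℝ] (TangentSpace I x →L[ℝ] ℝ) :=
  LinearEquiv.ofInjectiveOfFinrankEq (g.inner x : TangentSpace I x →ₗ[ℝ] _) (flat_injective g x) (by
    rw [← (LinearMap.toContinuousLinearMap (𝕜 := ℝ) (E := TangentSpace I x)
      (F' := ℝ)).finrank_eq, Module.finrank_linearMap_self])

/-- The inverse of `flat`: the vector `v` with `g(v, ·) = l`. -/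
def sharp (g : RMetric I M) (x : M) :
   (TangentSpace I x →L[ℝ] ℝ) →ₗ[ℝ] TangentSpace I x := (flat g x).symm

theorem inner_sharp (g : RMetric I M) (x : M) (l : TangentSpace I x →L[ℝ] ℝ) (v) :
    g.inner x (sharp g x l) v = l v :=
  congrArg (fun l ↦ l v) ((flat g x).apply_symm_apply l)

open Classical in
/-- `leviCivitaFun g Y x v` is `∇_v Y` at `x`, the vector determined by the Koszul formula;
by convention it is `0` if `Y` is not differentiable at `x`. -/
def leviCivitaFun (g : RMetric I M) (Y : VField I M) (x : M) :
    TangentSpace I x →L[ℝ] TangentSpace I x :=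
  if hY : MDiffAt (T% Y) x then
    (2⁻¹ : ℝ) • LinearMap.toContinuousLinearMap
      (sharp g x ∘ₗ (TensorialAt.mkHom₂ (I := I) (F := E) (F' := E)
        (fun X Z : VField I M ↦ koszul g X Y Z x) x
        (fun _ hZ ↦ koszul_left g hY hZ) (fun _ hX ↦ koszul_right g hX hY)).toLinearMap)
  else 0

theorem inner_leviCivitaFun (g : RMetric I M) {X Y Z : VField I M} {x : M}
    (hX : MDiffAt (T% X) x) (hY : MDiffAt (T% Y) x) (hZ : MDiffAt (T% Z) x) :
    2 * g.inner x (leviCivitaFun g Y x (X x)) (Z x) = koszul g X Y Z x := by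
  simp [leviCivitaFun, hY, inner_sharp]
  rw [TensorialAt.mkHom₂_apply _ _ hX hZ]

theorem leviCivitaFun_eq (g : RMetric I M) {X Y : VField I M} {x : M}
    (hX : MDiffAt (T% X) x) (hY : MDiffAt (T% Y) x) {w : TangentSpace I x}
    (h : ∀ Z : VField I M, MDiffAt (T% Z) x → 2 * g.inner x w (Z x) = koszul g X Y Z x) :
    leviCivitaFun g Y x (X x) = w := by
  apply eq_of_inner_eq g
  intro v
  have hZ : MDiffAt (T% (FiberBundle.extend E v : VField I M)) x := mdifferentiableAt_extend ..
  have h1 := inner_leviCivitaFun g hX hY hZ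
  have h2 := h _ hZ
  simp at h1 h2
  linarith

theorem koszul_mid_add (g : RMetric I M) {X Y Y' Z : VField I M} {x : M}
    (hX : MDiffAt (T% X) x) (hY : MDiffAt (T% Y) x) (hY' : MDiffAt (T% Y') x)
    (hZ : MDiffAt (T% Z) x) :
    koszul g X (Y + Y') Z x = koszul g X Y Z x + koszul g X Y' Z x := by
  have h1 : (fun y ↦ g.inner y ((Y + Y') y) (Z y)) =
      fun y ↦ g.inner y (Y y) (Z y) + g.inner y (Y' y) (Z y) := by
    ext; simp
  have h2 : (fun y ↦ g.inner y (X y) ((Y + Y') y)) =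
      fun y ↦ g.inner y (X y) (Y y) + g.inner y (X y) (Y' y) := by
    ext; simp
  simp only [koszul]
  rw [h1, h2, mvfderiv_fun_add (g.mdifferentiableAt hY hZ) (g.mdifferentiableAt hY' hZ),
    mvfderiv_fun_add (g.mdifferentiableAt hX hY) (g.mdifferentiableAt hX hY'),
    mlieBracket_add_left hY hY', mlieBracket_add_right hY hY']
  simp
  ring

theorem koszul_mid_smul (g : RMetric I M) {f : M → ℝ} {X Y Z : VField I M} {x : M}
    (hf : MDiffAt f x) (hX : MDiffAt (T% X) x) (hY : MDiffAt (T% Y) x) (hZ : MDiffAt (T% Z) x) :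
    koszul g X (f • Y) Z x =
      f x * koszul g X Y Z x + 2 * (d% f x (X x) * g.inner x (Y x) (Z x)) := by
  have h1 : (fun y ↦ g.inner y ((f • Y) y) (Z y)) = fun y ↦ f y * g.inner y (Y y) (Z y) := by
    ext; simp
  have h2 : (fun y ↦ g.inner y (X y) ((f • Y) y)) = fun y ↦ f y * g.inner y (X y) (Y y) := by
    ext; simp
  simp only [koszul]
  rw [h1, h2, mvfderiv_fun_mul hf (g.mdifferentiableAt hY hZ),
    mvfderiv_fun_mul hf (g.mdifferentiableAt hX hY), mlieBracket_smul_left hf hY,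
    mlieBracket_smul_right hf hY]
  simp [g.symm x (Y x) (X x)]
  ring

theorem isCovariantDerivativeOn_leviCivitaFun (g : RMetric I M) :
    IsCovariantDerivativeOn E (leviCivitaFun g) where
  add {Y Y' x} hY hY' _ := by
    ext v
    have hX : MDiffAt (T% (extend E v : VField I M)) x := mdifferentiableAt_extend ..
    have h := fun w ↦ leviCivitaFun_eq g (w := w) hX (mdifferentiableAt_add_section hY hY')
    simp only [extend_apply_self] at h
    apply h
    intro Z hZ
    rw [koszul_mid_add g hX hY hY' hZ, ← inner_leviCivitaFun g hX hY hZ,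
      ← inner_leviCivitaFun g hX hY' hZ]
    simp
    ring
  leibniz {Y f x} hY hf _ := by
    ext v
    have hX : MDiffAt (T% (extend E v : VField I M)) x := mdifferentiableAt_extend ..
    have h := fun w ↦ leviCivitaFun_eq g (w := w) hX (hf.smul_section hY)
    simp only [extend_apply_self] at h
    apply h
    intro Z hZ
    have := koszul_mid_smul g hf hX hY hZ
    refine Eq.trans ?_ this.symm
    rw [← inner_leviCivitaFun g hX hY hZ]
    simp
    ring

/-- The Levi-Civita connection of `g`; `leviCivita g Y x (X x)` is `∇_X Y` at `x`. It is torsion-free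
and compatible with `g`, as shown below. -/
def leviCivita (g : RMetric I M) : CovariantDerivative I E (fun x : M ↦ TangentSpace I x) where
  toFun := leviCivitaFun g
  isCovariantDerivativeOnUniv := isCovariantDerivativeOn_leviCivitaFun g

theorem leviCivita_torsion (g : RMetric I M) {X Y : VField I M} {x : M}
    (hX : MDiffAt (T% X) x) (hY : MDiffAt (T% Y) x) :
    leviCivita g Y x (X x) - leviCivita g X x (Y x) = mlieBracket I X Y x := by
  apply eq_of_inner_eq g
  intro v
  have hZ : MDiffAt (T% (extend E v : VField I M)) x := mdifferentiableAt_extend ..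
  have h1 := inner_leviCivitaFun g hX hY hZ
  have h2 := inner_leviCivitaFun g hY hX hZ
  have h3 : (fun y ↦ g.inner y (X y) (Y y)) = fun y ↦ g.inner y (Y y) (X y) := by
    ext; rw [g.symm]
  simp only [koszul, mlieBracket_swap_apply (V := Y) (W := X), h3, extend_apply_self] at h1 h2
  simp [leviCivita] at h1 h2 ⊢
  linarith

theorem leviCivita_metric (g : RMetric I M) {X Y Z : VField I M} {x : M}
    (hX : MDiffAt (T% X) x) (hY : MDiffAt (T% Y) x) (hZ : MDiffAt (T% Z) x) :
    d% (fun y ↦ g.inner y (Y y) (Z y)) x (X x) =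
      g.inner x (leviCivita g Y x (X x)) (Z x) + g.inner x (Y x) (leviCivita g Z x (X x)) := by
  have h1 := inner_leviCivitaFun g hX hY hZ
  have h2 := inner_leviCivitaFun g hX hZ hY
  have h3 : (fun y ↦ g.inner y (Z y) (Y y)) = fun y ↦ g.inner y (Y y) (Z y) := by
    ext; rw [g.symm]
  simp only [koszul, mlieBracket_swap_apply (V := Z) (W := Y), h3] at h1 h2
  rw [g.symm x (Y x)]
  simp [leviCivita] at h1 h2 ⊢
  linarith

/-- The `g`-orthogonal projection `π^⊥` of the tangent space onto the orthogonal complement of `W`. -/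
def perpProj (g : RMetric I M) {x : M} (W : Submodule ℝ (TangentSpace I x)) :
    TangentSpace I x →ₗ[ℝ] TangentSpace I x :=
  letI : RiemannianBundle (fun x : M ↦ TangentSpace I x) := ⟨g.toRiemannianMetric⟩
  Wᗮ.starProjection.toLinearMap

theorem perpProj_inner (g : RMetric I M) {x : M} (W : Submodule ℝ (TangentSpace I x))
    (v w : TangentSpace I x) (hw : w ∈ W) : g.inner x (perpProj g W v) w = 0 := by
  let : RiemannianBundle (fun x : M ↦ TangentSpace I x) := ⟨g.toRiemannianMetric⟩
  exact Submodule.inner_left_of_mem_orthogonal hw (Wᗮ.starProjection_apply_mem v)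

theorem sub_perpProj_mem (g : RMetric I M) {x : M} (W : Submodule ℝ (TangentSpace I x))
    (v : TangentSpace I x) : v - perpProj g W v ∈ W := by
  let : RiemannianBundle (fun x : M ↦ TangentSpace I x) := ⟨g.toRiemannianMetric⟩
  have := Wᗮ.sub_starProjection_mem_orthogonal v
  rwa [Submodule.orthogonal_orthogonal] at this

/-- The form `h(X, Y) = π^⊥ ∇_X Y` of the foliation, for local sections `X`, `Y` of it. -/
def fundamentalForm (g : RMetric I M) (F : Foliation I M k) (X Y : VField I M) : VField I M :=
  fun x ↦ perpProj g (F.plane x) (leviCivita g Y x (X x))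

/-- The mean curvature vector `H = ∑ h(ξ_i, ξ_i)`, for a local orthonormal frame `ξ` of the foliation
near the given point (the value does not depend on the frame). -/
def meanCurvature (g : RMetric I M) (F : Foliation I M k) : VField I M := fun x ↦
  let ξ : Fin k → VField I M := (exists_orthonormalFrame g F x).choose_spec.2.2.choose
  ∑ i, fundamentalForm g F (ξ i) (ξ i) x

/-- The gradient `∇φ` with respect to `g`. -/
def gradient (g : RMetric I M) (φ : C^∞⟮I, M; ℝ⟯) : VField I M := fun x ↦ sharp g x (d% φ x)

/-- The foliation is minimal: `H = 0`. -/
def IsMinimal (g : RMetric I M) (F : Foliation I M k) : Prop := ∀ x, meanCurvature g F x = 0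

/-- The foliation is totally geodesic: `h(X, Y) = 0` for all local sections `X`, `Y` of it. -/
def IsTotallyGeodesic (g : RMetric I M) (F : Foliation I M k) : Prop :=
  ∀ (U : Set M) (X Y : VField I M), IsOpen U → CMDiff[U] ∞ (T% X) → CMDiff[U] ∞ (T% Y) →
    (∀ x ∈ U, X x ∈ F.plane x) → (∀ x ∈ U, Y x ∈ F.plane x) → ∀ x ∈ U, fundamentalForm g F X Y x = 0

/-- The conformal class `[g]`: all metrics `e^{2φ} g` with `φ` a smooth function on `M`. -/
def conformalClass (g : RMetric I M) : Set (RMetric I M) :=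
  {g' | ∃ φ : C^∞⟮I, M; ℝ⟯, g' = conformalChange g φ}

/-- The foliation is minimal for some metric in the conformal class of `g`. -/
def IsConformallyMinimal (g : RMetric I M) (F : Foliation I M k) : Prop :=
  ∃ g' ∈ conformalClass g, IsMinimal g' F

end ConfFol

end

/-!
Under `ḡ = e^{2φ} g` the Koszul formula gives
`∇̄_X Y = ∇_X Y + dφ(X) Y + dφ(Y) X - g(X, Y) ∇φ` (`leviCivita_conformalChange`).
For sections `X`, `Y` of the foliation the two middle terms are killed by `π^⊥`, and `π^⊥` is the
same for `g` and `ḡ`, so `h̄(X, Y) = h(X, Y) - g(X, Y) π^⊥ ∇φ` (`fundamentalForm_conformalChange`).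
This settles the totally geodesic case: if `h = 0` and `k ≥ 1`, then `h̄` vanishes exactly when
`π^⊥ ∇φ` does.

For the mean curvature one sums over a `ḡ`-orthonormal frame `η`, on which `g(η_i, η_i) = e^{-2φ}`.
The frames defining `H` and `H̄` are chosen independently, so `∑ h(η_i, η_i)` has to be compared with
`∑ h(ξ_i, ξ_i)` for an unrelated `g`-orthonormal frame `ξ`. Since `h` is tensorial
(`IsOrthonormalFrame.fundamentalForm_eq_sum`) and the matrix from `ξ` to `η` is `e^{-φ}` times an
orthogonal one, the two sums differ by the factor `e^{-2φ}`
(`IsOrthonormalFrame.sum_fundamentalForm_conformalChange`). Minimality in the conformal class is then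
the vanishing of `H - k π^⊥ ∇φ`.
-/

noncomputable section

namespace ConfFol

open scoped Pointwise Topology
open Bundle FiberBundle Manifold VectorField

section General

variable {E : Type*} [NormedAddCommGroup E] [NormedSpace ℝ E]
  {H : Type*} [TopologicalSpace H] {I : ModelWithCorners ℝ E H}
  {M : Type*} [TopologicalSpace M] [ChartedSpace H M] {k : ℕ}

/-! ### Conformal change of the Koszul form -/

theorem mdifferentiableAt_exp_two_mul (φ : C^∞⟮I, M; ℝ⟯) (x : M) :
    MDiffAt (fun y ↦ Real.exp (2 * φ y)) x :=
  (Real.contDiff_exp.comp_contMDiff (n := ∞)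
    (contMDiff_const.mul φ.contMDiff)).mdifferentiableAt (by simp)

theorem mvfderiv_exp_two_mul (φ : C^∞⟮I, M; ℝ⟯) (x : M) (v : TangentSpace I x) :
    d% (fun y ↦ Real.exp (2 * φ y)) x v = Real.exp (2 * φ x) * (2 * d% φ x v) := by
  have hφ : MDiffAt φ x := φ.contMDiff.mdifferentiableAt (by simp)
  have h2 : HasFDerivAt (fun t : ℝ ↦ Real.exp (2 * t))
      ((Real.exp (2 * φ x) * 2) • ContinuousLinearMap.id ℝ ℝ) (φ x) := by
    have := (((hasDerivAt_id' (φ x)).const_mul (2 : ℝ)).exp).hasFDerivAt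
    refine this.congr_fderiv ?_
    ext
    simp
  have h := (h2.hasMFDerivAt.comp x hφ.hasMFDerivAt).mfderiv
  have h' := congrArg (fun L ↦ L v) h
  refine h'.trans ?_
  change (Real.exp (2 * φ x) * 2) * _ = _
  rw [mul_assoc]
  rfl

variable [IsManifold I ∞ M]

theorem conformalChange_inner (g : RMetric I M) (φ : C^∞⟮I, M; ℝ⟯) (x : M)
    (v w : TangentSpace I x) :
    (conformalChange g φ).inner x v w = Real.exp (2 * φ x) * g.inner x v w := rfl

theorem mvfderiv_conformalChange_inner (g : RMetric I M) (φ : C^∞⟮I, M; ℝ⟯) {Y Z : VField I M}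
    {x : M} (hY : MDiffAt (T% Y) x) (hZ : MDiffAt (T% Z) x) (v : TangentSpace I x) :
    d% (fun y ↦ (conformalChange g φ).inner y (Y y) (Z y)) x v =
      Real.exp (2 * φ x) * (d% (fun y ↦ g.inner y (Y y) (Z y)) x v +
        2 * d% φ x v * g.inner x (Y x) (Z x)) := by
  simp only [conformalChange_inner]
  rw [mvfderiv_fun_mul (mdifferentiableAt_exp_two_mul φ x) (g.mdifferentiableAt hY hZ)]
  simp [mvfderiv_exp_two_mul]
  ring

/-- Beyond the overall factor `e^{2φ}`, the Koszul form is only corrected by differentiating that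
factor in its three derivative terms. -/
theorem koszul_conformalChange (g : RMetric I M) (φ : C^∞⟮I, M; ℝ⟯) {X Y Z : VField I M}
    {x : M} (hX : MDiffAt (T% X) x) (hY : MDiffAt (T% Y) x) (hZ : MDiffAt (T% Z) x) :
    koszul (conformalChange g φ) X Y Z x =
      Real.exp (2 * φ x) * (koszul g X Y Z x + 2 * (d% φ x (X x) * g.inner x (Y x) (Z x) +
        d% φ x (Y x) * g.inner x (X x) (Z x) - d% φ x (Z x) * g.inner x (X x) (Y x))) := by
  simp only [koszul]
  rw [mvfderiv_conformalChange_inner g φ hY hZ, mvfderiv_conformalChange_inner g φ hX hZ,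
    mvfderiv_conformalChange_inner g φ hX hY]
  simp only [conformalChange_inner]
  ring

/-! ### Orthonormal frames -/

theorem mdifferentiableAt_section_of_contMDiffOn {U : Set M} (hU : IsOpen U) {x : M} (hx : x ∈ U)
    {X : VField I M} (hX : CMDiff[U] ∞ (T% X)) : MDiffAt (T% X) x :=
  (hX.contMDiffAt (hU.mem_nhds hx)).mdifferentiableAt (by simp)

namespace IsOrthonormalFrame

variable {g : RMetric I M} {F : Foliation I M k} {U : Set M} {ξ : Fin k → VField I M}

theorem mdifferentiableAt (hξ : IsOrthonormalFrame g F U ξ) (hU : IsOpen U) {x : M} (hx : x ∈ U)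
    (i : Fin k) : MDiffAt (T% (ξ i)) x :=
  mdifferentiableAt_section_of_contMDiffOn hU hx (hξ.smooth i)

theorem mem_plane (hξ : IsOrthonormalFrame g F U ξ) {x : M} (hx : x ∈ U) (i : Fin k) :
    ξ i x ∈ F.plane x :=
  hξ.span_eq x hx ▸ Submodule.subset_span ⟨i, rfl⟩

theorem sum_inner_smul (hξ : IsOrthonormalFrame g F U ξ) {x : M} (hx : x ∈ U)
    {v : TangentSpace I x} (hv : v ∈ F.plane x) : ∑ j, g.inner x v (ξ j x) • ξ j x = v := by
  rw [← hξ.span_eq x hx] at hv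
  obtain ⟨c, rfl⟩ := (Submodule.mem_span_range_iff_exists_fun ℝ).1 hv
  simp [hξ.orthonormal x hx]

end IsOrthonormalFrame

/-! ### The conformally changed connection -/

variable [FiniteDimensional ℝ E]

theorem inner_gradient (g : RMetric I M) (φ : C^∞⟮I, M; ℝ⟯) (x : M) (v : TangentSpace I x) :
    g.inner x (gradient g φ x) v = d% φ x v :=
  inner_sharp g x _ v

/-- The classical formula `∇̄_X Y = ∇_X Y + dφ(X) Y + dφ(Y) X - g(X, Y) ∇φ`. -/
theorem leviCivita_conformalChange (g : RMetric I M) (φ : C^∞⟮I, M; ℝ⟯) {X Y : VField I M}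
    {x : M} (hX : MDiffAt (T% X) x) (hY : MDiffAt (T% Y) x) :
    leviCivita (conformalChange g φ) Y x (X x) =
      leviCivita g Y x (X x) + d% φ x (X x) • Y x + d% φ x (Y x) • X x
        - g.inner x (X x) (Y x) • gradient g φ x := by
  refine leviCivitaFun_eq (conformalChange g φ) hX hY fun Z hZ ↦ ?_
  rw [koszul_conformalChange g φ hX hY hZ, ← inner_leviCivitaFun g hX hY hZ,
    conformalChange_inner]
  simp [inner_gradient, leviCivita]
  ring

/-! ### The orthogonal projection and the second fundamental form -/

/-- The projection `π^⊥ v` is characterized by `π^⊥ v ⊥ W` and `v - π^⊥ v ∈ W`. -/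
theorem perpProj_eq_of (g : RMetric I M) {x : M} (W : Submodule ℝ (TangentSpace I x))
    {v u : TangentSpace I x} (hu : ∀ w ∈ W, g.inner x u w = 0) (hvu : v - u ∈ W) :
    perpProj g W v = u := by
  have hmem : perpProj g W v - u ∈ W := by
    have := W.sub_mem hvu (sub_perpProj_mem g W v)
    simpa using this
  have h0 : g.inner x (perpProj g W v - u) (perpProj g W v - u) = 0 := by
    conv_lhs => rw [map_sub (g.inner x)]
    rw [sub_apply, perpProj_inner g W v _ hmem, hu _ hmem, sub_zero]
  by_contra hne
  exact (g.pos x _ (sub_ne_zero.2 hne)).ne' h0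

theorem perpProj_eq_zero_iff (g : RMetric I M) {x : M} (W : Submodule ℝ (TangentSpace I x))
    (v : TangentSpace I x) : perpProj g W v = 0 ↔ v ∈ W := by
  refine ⟨fun h ↦ ?_, fun h ↦ perpProj_eq_of g W (by simp) (by simpa using h)⟩
  simpa [h] using sub_perpProj_mem g W v

/-- Orthogonality, hence `π^⊥`, only depends on the conformal class. -/
theorem perpProj_conformalChange (g : RMetric I M) (φ : C^∞⟮I, M; ℝ⟯) {x : M}
    (W : Submodule ℝ (TangentSpace I x)) (v : TangentSpace I x) :
    perpProj (conformalChange g φ) W v = perpProj g W v :=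
  perpProj_eq_of _ W (fun w hw ↦ by simp [conformalChange_inner, perpProj_inner g W v w hw])
    (sub_perpProj_mem g W v)

/-- On sections of the foliation, `h̄(X, Y) = h(X, Y) - g(X, Y) π^⊥ ∇φ`: the other two correction
terms of the connection are tangent to the leaves. -/
theorem fundamentalForm_conformalChange (g : RMetric I M) (F : Foliation I M k)
    (φ : C^∞⟮I, M; ℝ⟯) {X Y : VField I M} {x : M} (hX : MDiffAt (T% X) x)
    (hY : MDiffAt (T% Y) x) (hXp : X x ∈ F.plane x) (hYp : Y x ∈ F.plane x) :
    fundamentalForm (conformalChange g φ) F X Y x =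
      fundamentalForm g F X Y x
        - g.inner x (X x) (Y x) • perpProj g (F.plane x) (gradient g φ x) := by
  simp only [fundamentalForm]
  rw [leviCivita_conformalChange g φ hX hY, perpProj_conformalChange]
  simp [(perpProj_eq_zero_iff g _ _).2 hXp, (perpProj_eq_zero_iff g _ _).2 hYp]

/-! ### Tensoriality and traces of the second fundamental form -/

namespace IsOrthonormalFrame

variable {g : RMetric I M} {F : Foliation I M k} {U : Set M} {ξ : Fin k → VField I M}

/-- The second fundamental form is tensorial: `h(X, Y)` at `x` is determined by `X x`, `Y x` and the
derivatives of one fixed frame. The Leibniz terms are tangent to the foliation. -/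
theorem fundamentalForm_eq_sum (hξ : IsOrthonormalFrame g F U ξ) (hU : IsOpen U) {x : M}
    (hx : x ∈ U) {X Y : VField I M} (hY : MDiffAt (T% Y) x)
    (hYp : ∀ᶠ y in 𝓝 x, Y y ∈ F.plane y) :
    fundamentalForm g F X Y x =
      ∑ j, g.inner x (Y x) (ξ j x) • perpProj g (F.plane x) (leviCivita g (ξ j) x (X x)) := by
  have hd := hξ.mdifferentiableAt hU hx
  have hcov := isCovariantDerivativeOn_leviCivitaFun g
  have hc (j : Fin k) : MDiffAt (fun y ↦ g.inner y (Y y) (ξ j y)) x :=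
    g.mdifferentiableAt hY (hd j)
  have hs (j : Fin k) :
      MDiffAt (T% ((fun y ↦ g.inner y (Y y) (ξ j y)) • ξ j : VField I M)) x :=
    (hc j).smul_section (hd j)
  -- the covariant derivative of a finite sum of sections
  have hsum (s : Finset (Fin k)) :
      MDiffAt (T% (∑ j ∈ s, (fun y ↦ g.inner y (Y y) (ξ j y)) • ξ j : VField I M)) x ∧
      leviCivitaFun g (∑ j ∈ s, (fun y ↦ g.inner y (Y y) (ξ j y)) • ξ j) x =
        ∑ j ∈ s, leviCivitaFun g ((fun y ↦ g.inner y (Y y) (ξ j y)) • ξ j) x := by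
    induction s using Finset.induction_on with
    | empty =>
      simp only [Finset.sum_empty]
      exact ⟨mdifferentiableAt_zeroSection .., hcov.zero⟩
    | insert a s ha ih =>
      rw [Finset.sum_insert ha, Finset.sum_insert ha, ← ih.2]
      exact ⟨mdifferentiableAt_add_section (hs a) ih.1, hcov.add (hs a) ih.1⟩
  have hcongr : leviCivitaFun g Y x =
      leviCivitaFun g (∑ j, (fun y ↦ g.inner y (Y y) (ξ j y)) • ξ j) x := by
    refine hcov.congr_of_eventuallyEq hY (hsum Finset.univ).1 Filter.univ_mem ?_
    filter_upwards [hYp, hU.mem_nhds hx] with y hy hyU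
    simpa using (hξ.sum_inner_smul hyU hy).symm
  change perpProj g (F.plane x) (leviCivitaFun g Y x (X x)) = _
  rw [hcongr, (hsum Finset.univ).2, sum_apply, map_sum]
  refine Finset.sum_congr rfl fun j _ ↦ ?_
  rw [hcov.leibniz (hd j) (hc j)]
  simp [(perpProj_eq_zero_iff g _ _).2 (hξ.mem_plane hx j)]
  rfl

/-- The sum of `h(η_i, η_i)` over a frame `η` orthonormal for `e^{2φ} g` is `e^{-2φ}` times the
`g`-trace of `h`. The case `φ = 0` is the independence of the mean curvature from the frame. -/
theorem sum_fundamentalForm_conformalChange {φ : C^∞⟮I, M; ℝ⟯} {V : Set M}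
    {η : Fin k → VField I M} (hξ : IsOrthonormalFrame g F U ξ) (hU : IsOpen U)
    (hη : IsOrthonormalFrame (conformalChange g φ) F V η) (hV : IsOpen V) {x : M}
    (hxU : x ∈ U) (hxV : x ∈ V) :
    ∑ i, fundamentalForm g F (η i) (η i) x =
      Real.exp (-2 * φ x) • ∑ j, fundamentalForm g F (ξ j) (ξ j) x := by
  -- the coefficients `η_i = ∑ j, A i j • ξ_j`, with `e^{2φ} A Aᵀ = 1`
  set A : Matrix (Fin k) (Fin k) ℝ := .of fun i j ↦ g.inner x (η i x) (ξ j x) with hA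
  have hexp : Real.exp (-2 * φ x) * Real.exp (2 * φ x) = 1 := by
    rw [← Real.exp_add]; simp
  have hrow : (Real.exp (2 * φ x) • A) * A.transpose = 1 := by
    ext i l
    rw [Matrix.one_apply, ← hη.orthonormal x hxV i l, conformalChange_inner]
    conv_rhs => rw [← hξ.sum_inner_smul hxU (hη.mem_plane hxV l)]
    simp [Matrix.mul_apply, hA, Finset.mul_sum]
    exact Finset.sum_congr rfl fun j _ ↦ by ring
  -- a right inverse of a square matrix is a left inverse
  have hcol (j l : Fin k) : ∑ i, A i j * A i l = if j = l then Real.exp (-2 * φ x) else 0 := by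
    have h : (A.transpose * (Real.exp (2 * φ x) • A)) j l = (1 : Matrix _ _ ℝ) j l := by
      rw [mul_eq_one_comm.1 hrow]
    simp only [Matrix.mul_apply, Matrix.transpose_apply, Matrix.smul_apply, smul_eq_mul,
      Matrix.one_apply, mul_left_comm _ (Real.exp _), ← Finset.mul_sum] at h
    calc _ = Real.exp (-2 * φ x) * (Real.exp (2 * φ x) * ∑ i, A i j * A i l) := by
          rw [← mul_assoc, hexp, one_mul]
      _ = _ := by rw [h]; split_ifs <;> simp
  have hev : ∀ i, ∀ᶠ y in 𝓝 x, η i y ∈ F.plane y := fun i ↦ by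
    filter_upwards [hV.mem_nhds hxV] with y hy using hη.mem_plane hy i
  have hexpand (i : Fin k) : fundamentalForm g F (η i) (η i) x =
      ∑ j, ∑ l, (A i j * A i l) • perpProj g (F.plane x) (leviCivita g (ξ j) x (ξ l x)) := by
    rw [hξ.fundamentalForm_eq_sum hU hxU (hη.mdifferentiableAt hV hxV i) (hev i)]
    refine Finset.sum_congr rfl fun j _ ↦ ?_
    have h := congrArg (fun v ↦ perpProj g (F.plane x) (leviCivita g (ξ j) x v))
      (hξ.sum_inner_smul hxU (hη.mem_plane hxV i))
    simp only [map_sum, map_smul] at h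
    rw [← h, Finset.smul_sum]
    simp only [smul_smul]
    rfl
  simp only [hexpand]
  rw [Finset.sum_comm, Finset.smul_sum]
  refine Finset.sum_congr rfl fun j _ ↦ ?_
  rw [Finset.sum_comm]
  simp only [← Finset.sum_smul, hcol]
  simp [fundamentalForm]

end IsOrthonormalFrame

/-! ### Conformal change of minimal and totally geodesic foliations -/

theorem meanCurvature_conformalChange (g : RMetric I M) (F : Foliation I M k)
    (φ : C^∞⟮I, M; ℝ⟯) (x : M) :
    meanCurvature (conformalChange g φ) F x = Real.exp (-2 * φ x) •
      (meanCurvature g F x - (k : ℝ) • perpProj g (F.plane x) (gradient g φ x)) := by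
  -- `meanCurvature` uses chosen frames for `g` and `e^{2φ} g`, which need not be related by scaling
  have h1 := (exists_orthonormalFrame g F x).choose_spec
  have h2 := (exists_orthonormalFrame (conformalChange g φ) F x).choose_spec
  have hξ := h1.2.2.choose_spec
  have hη := h2.2.2.choose_spec
  have hnorm (i : Fin k) : g.inner x (h2.2.2.choose i x) (h2.2.2.choose i x) =
      Real.exp (-2 * φ x) := by
    have h := hη.orthonormal x h2.2.1 i i
    rw [conformalChange_inner, if_pos rfl] at h
    rw [neg_mul, Real.exp_neg]
    exact eq_inv_of_mul_eq_one_right h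
  have hd := hη.mdifferentiableAt h2.1 h2.2.1
  have hp := hη.mem_plane h2.2.1
  change ∑ i, fundamentalForm (conformalChange g φ) F (h2.2.2.choose i) (h2.2.2.choose i) x = _
  simp only [fundamentalForm_conformalChange g F φ (hd _) (hd _) (hp _) (hp _), hnorm,
    Finset.sum_sub_distrib]
  rw [hξ.sum_fundamentalForm_conformalChange h1.1 hη h2.1 h1.2.1 h2.2.1, smul_sub]
  simp [meanCurvature, smul_comm (k : ℝ), ← Nat.cast_smul_eq_nsmul ℝ]

theorem isMinimal_conformalChange_iff (g : RMetric I M) (F : Foliation I M k) (hk : 1 ≤ k)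
    (φ : C^∞⟮I, M; ℝ⟯) :
    IsMinimal (conformalChange g φ) F ↔ ∀ x,
      perpProj g (F.plane x) (gradient g φ x) = (1 / (k : ℝ)) • meanCurvature g F x := by
  have hk0 : (k : ℝ) ≠ 0 := by positivity
  refine forall_congr' fun x ↦ ?_
  rw [meanCurvature_conformalChange, smul_eq_zero_iff_right (Real.exp_ne_zero _), sub_eq_zero,
    one_div, eq_inv_smul_iff₀ hk0, eq_comm]

theorem isTotallyGeodesic_conformalChange_iff (g : RMetric I M) (F : Foliation I M k)
    (hk : 1 ≤ k) (hF : IsTotallyGeodesic g F) (φ : C^∞⟮I, M; ℝ⟯) :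
    IsTotallyGeodesic (conformalChange g φ) F ↔ ∀ x, gradient g φ x ∈ F.plane x := by
  refine ⟨fun h x ↦ ?_, fun h U X Y hU hX hY hXp hYp x hx ↦ ?_⟩
  · obtain ⟨U, hU, hx, ξ, hξ⟩ := exists_orthonormalFrame g F x
    -- evaluating on a single unit vector suffices; it exists because `1 ≤ k`
    let i : Fin k := ⟨0, hk⟩
    have hp : ∀ y ∈ U, ξ i y ∈ F.plane y := fun y hy ↦ hξ.mem_plane hy i
    have hd := hξ.mdifferentiableAt hU hx i
    have h1 := h U (ξ i) (ξ i) hU (hξ.smooth i) (hξ.smooth i) hp hp x hx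
    rw [fundamentalForm_conformalChange g F φ hd hd (hp x hx) (hp x hx),
      hF U (ξ i) (ξ i) hU (hξ.smooth i) (hξ.smooth i) hp hp x hx,
      hξ.orthonormal x hx] at h1
    exact (perpProj_eq_zero_iff g _ _).1 (by simpa using h1)
  · rw [fundamentalForm_conformalChange g F φ (mdifferentiableAt_section_of_contMDiffOn hU hx hX)
      (mdifferentiableAt_section_of_contMDiffOn hU hx hY) (hXp x hx) (hYp x hx),
      hF U X Y hU hX hY hXp hYp x hx, (perpProj_eq_zero_iff g _ _).2 (h x)]
    simp

end General

end ConfFol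

end

theorem lemma8 {n k : ℕ} {M : Type*} [TopologicalSpace M]
    [ChartedSpace (EuclideanSpace ℝ (Fin n)) M] [IsManifold (𝓡 n) ∞ M]
    (g : ConfFol.RMetric (𝓡 n) M) (F : ConfFol.Foliation (𝓡 n) M k) :
    -- conformal mean curvature formula
    (∀ (φ : C^∞⟮𝓡 n, M; ℝ⟯) (x : M),
      ConfFol.meanCurvature (ConfFol.conformalChange g φ) F x =
        Real.exp (-2 * φ x) • (ConfFol.meanCurvature g F x -
          (k : ℝ) • ConfFol.perpProj g (F.plane x) (ConfFol.gradient g φ x))) ∧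
    (1 ≤ k →
      -- characterization of conformally minimal foliations
      (ConfFol.IsConformallyMinimal g F ↔ ∃ φ : C^∞⟮𝓡 n, M; ℝ⟯, ∀ x,
        ConfFol.perpProj g (F.plane x) (ConfFol.gradient g φ x) =
          (1 / (k : ℝ)) • ConfFol.meanCurvature g F x) ∧
      -- such a function gives a minimal metric
      (∀ φ : C^∞⟮𝓡 n, M; ℝ⟯,
        (∀ x, ConfFol.perpProj g (F.plane x) (ConfFol.gradient g φ x) =
          (1 / (k : ℝ)) • ConfFol.meanCurvature g F x) →
        ConfFol.IsMinimal (ConfFol.conformalChange g φ) F) ∧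
      -- conformal change of totally geodesic foliations
      (ConfFol.IsTotallyGeodesic g F → ∀ φ : C^∞⟮𝓡 n, M; ℝ⟯,
        (ConfFol.IsTotallyGeodesic (ConfFol.conformalChange g φ) F ↔
          ∀ x, ConfFol.gradient g φ x ∈ F.plane x))) := by
  refine ⟨ConfFol.meanCurvature_conformalChange g F, fun hk ↦ ⟨⟨?_, ?_⟩, ?_, ?_⟩⟩
  · rintro ⟨_, ⟨φ, rfl⟩, h⟩
    exact ⟨φ, (ConfFol.isMinimal_conformalChange_iff g F hk φ).1 h⟩
  · rintro ⟨φ, h⟩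
    exact ⟨_, ⟨φ, rfl⟩, (ConfFol.isMinimal_conformalChange_iff g F hk φ).2 h⟩
  · exact fun φ h ↦ (ConfFol.isMinimal_conformalChange_iff g F hk φ).2 h
  · exact fun hF φ ↦ ConfFol.isTotallyGeodesic_conformalChange_iff g F hk hF φ
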